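/- Let $k$ be a field, let $\mathcal C$ be a fusion category over $k$ (a $k$-linear abelian rigid monoidal category with $k$-bilinear tensor product, finite-dimensional spaces of morphisms, every object a finite direct sum of simple objects, finitely many simple objects up to isomorphism, and simple unit object), and let $\mathcal M$ be a $k$-linear abelian semisimple left module category over $\mathcal C$ (the action $\otimes:\mathcal C\times\mathcal M\to\mathcal M$ is $k$-bilinear on morphisms, spaces of morphisms in $\mathcal M$ are finite-dimensional, and every object of $\mathcal M$ is a finite direct sum of simple objects). Let $M\in\mathcal M$ be a generator, that is, for every $V\in\mathcal M$ there are $X\in\mathcal C$ and an epimorphism $X\otimes M\to V$. For all $N,V\in\mathcal M$ the internal Hom $\underline{\operatorname{Hom}}(N,V)\in\mathcal C$, i.e. an object representing the functor $X\mapsto\operatorname{Hom}_{\mathcal M}(X\otimes N,V)$, exists. Fix a choice of the internal Homs $\underline{\operatorname{Hom}}(M,V)$ for $V\in\mathcal M$, with evaluation morphisms $ev_{M,V}:\underline{\operatorname{Hom}}(M,V)\otimes M\to V$. Let $A=\underline{\operatorname{Hom}}(M,M)$, an algebra in $\mathcal C$ under composition; then $M$ is a left $A$-module in $\mathcal M$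 by $ev_{M,M}$, and each $\underline{\operatorname{Hom}}(M,V)$ is a right $A$-module in $\mathcal C$ by composition. For a right $A$-module $(U,q)$ in $\mathcal C$ let $U\otimes_AM\in\mathcal M$ be the coequalizer of $q\otimes id_M$ and $(id_U\otimes ev_{M,M})\circ a_{U,A,M}:(U\otimes A)\otimes M\to U\otimes M$, where $a$ is the associativity isomorphism of the action. Write $\mathrm{Mod}_{\mathcal C}(A)$ for the category of right $A$-modules in $\mathcal C$, a left $\mathcal C$-module category. Then $A$ is a semisimple algebra in $\mathcal C$ (that is, $\mathrm{Mod}_{\mathcal C}(A)$ is abelian and each of its objects is a finite direct sum of simple objects). The functor $F=\underline{\operatorname{Hom}}(M,-):\mathcal M\to\mathrm{Mod}_{\mathcal C}(A)$ is a $k$-linear equivalence of $\mathcal C$-module categories: it is a $k$-linear equivalence of categories, and the canonical morphisms $X\otimes\underline{\operatorname{Hom}}(M,V)\to\underline{\operatorname{Hom}}(M,X\otimes V)$ are isomorphisms. The functor $G=-\otimes_AM:\mathrm{Mod}_{\mathcal C}(A)\to\mathcal M$ is a quasi-inverse of $F$: there are natural isomorphisms $GF\cong id_{\mathcal M}$ and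 $FG\cong id_{\mathrm{Mod}_{\mathcal C}(A)}$. Moreover, for all $V\in\mathcal M$ and $U\in\mathrm{Mod}_{\mathcal C}(A)$: 1. $\underline{\operatorname{Hom}}(M,V)\otimes_AM\cong V$ in $\mathcal M$, and $U\cong\underline{\operatorname{Hom}}(M,U\otimes_AM)$ as right $A$-modules in $\mathcal C$; 2. $V$ is a simple object of $\mathcal M$ if and only if $\underline{\operatorname{Hom}}(M,V)$ is a simple object of $\mathrm{Mod}_{\mathcal C}(A)$; 3. $U$ is a simple object of $\mathrm{Mod}_{\mathcal C}(A)$ if and only if $U\otimes_AM$ is a simple object of $\mathcal M$. -/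

import Mathlib

open CategoryTheory MonoidalCategory MonoidalLeftAction Limits Opposite
open scoped MonObj

namespace FusionModule

universe w v v₁ v₂ u u₁ u₂

/-! ### Semisimple categories, fusion categories, semisimple module categories -/

/-- `X` is semisimple: it is a finite direct sum of simple objects (the empty sum is allowed). -/
def IsSemisimpleObj {C : Type u} [Category.{v} C] [HasZeroMorphisms C] (X : C) : Prop :=
  ∃ (n : ℕ) (S : Fin n → C) (b : Bicone S),
    (∀ i, Simple (S i)) ∧ Nonempty b.IsBilimit ∧ Nonempty (b.pt ≅ X)

/-- A preadditive category is semisimple if it is abelian and every object is a finite direct sum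
of simple objects. -/
structure IsSemisimpleCat (C : Type u) [Category.{v} C] [P : Preadditive C] : Prop where
  abelian : ∃ h : Abelian C, h.toPreadditive = P
  semisimple : ∀ X : C, IsSemisimpleObj X

/-- A `k`-linear abelian monoidal category with bilinear tensor product is a fusion category if it
is rigid and semisimple with finite-dimensional spaces of morphisms, has finitely many simple
objects up to isomorphism, and its unit object is simple. -/
structure IsFusionCat (k : Type w) [Field k] (C : Type u) [Category.{v} C] [Abelian C]
    [Linear k C] [MonoidalCategory C] [MonoidalPreadditive C] [MonoidalLinear k C] : Prop where
  finite_hom : ∀ X Y : C, Module.Finite k (X ⟶ Y)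
  semisimple : IsSemisimpleCat C
  finite_simple : ∃ (n : ℕ) (S : Fin n → C), ∀ X : C, Simple X → ∃ i, Nonempty (X ≅ S i)
  simple_unit : Simple (𝟙_ C)
  left_rigid : ∀ X : C, Nonempty (HasLeftDual X)
  right_rigid : ∀ X : C, Nonempty (HasRightDual X)

/-- A `k`-linear abelian category `D` with a left action of `C` is a semisimple `k`-linear module
category over `C` if the action is `k`-bilinear on morphisms and `D` is semisimple with
finite-dimensional spaces of morphisms. -/
structure IsSemisimpleModuleCat (k : Type w) [Field k] (C : Type u₁) [Category.{v₁} C] [Abelian C]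
    [Linear k C] [MonoidalCategory C] (D : Type u₂) [Category.{v₂} D] [Abelian D] [Linear k D]
    [MonoidalLeftAction C D] : Prop where
  add_left : ∀ {X Y : C} (f g : X ⟶ Y) (V : D), (f + g) ⊵ₗ V = f ⊵ₗ V + g ⊵ₗ V
  smul_left : ∀ {X Y : C} (r : k) (f : X ⟶ Y) (V : D), (r • f) ⊵ₗ V = r • f ⊵ₗ V
  add_right : ∀ (X : C) {V W : D} (f g : V ⟶ W), X ⊴ₗ (f + g) = X ⊴ₗ f + X ⊴ₗ g
  smul_right : ∀ (X : C) {V W : D} (r : k) (f : V ⟶ W), X ⊴ₗ (r • f) = r • X ⊴ₗ f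
  finite_hom : ∀ V W : D, Module.Finite k (V ⟶ W)
  semisimple : IsSemisimpleCat D

/-- `M` generates the `C`-module category `D`: every object of `D` is a quotient of some
`X ⊙ₗ M` with `X` in `C`. -/
def IsGenerator (C : Type u₁) [Category.{v₁} C] [MonoidalCategory C] {D : Type u₂}
    [Category.{v₂} D] [MonoidalLeftAction C D] (M : D) : Prop :=
  ∀ V : D, ∃ (X : C) (f : X ⊙ₗ M ⟶ V), Epi f

/-! ### Right modules over an algebra in a monoidal category -/

section RightModules

variable {C : Type u} [Category.{v} C] [MonoidalCategory C]

/-- A right module over the algebra `A` in `C`. -/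
structure RightMod (A : C) [MonObj A] where
  X : C
  act : X ⊗ A ⟶ X
  act_one : X ◁ η[A] ≫ act = (ρ_ X).hom
  act_mul : X ◁ μ[A] ≫ act = (α_ X A A).inv ≫ act ▷ A ≫ act

namespace RightMod

variable {A : C} [MonObj A]

/-- A morphism of right `A`-modules. -/
@[ext]
structure Hom (U U' : RightMod A) where
  hom : U.X ⟶ U'.X
  act_hom : U.act ≫ hom = hom ▷ A ≫ U'.act

instance : Category (RightMod A) where
  Hom U U' := Hom U U'
  id U := ⟨𝟙 U.X, by simp⟩
  comp f g := ⟨f.hom ≫ g.hom, by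
    rw [← Category.assoc, f.act_hom, Category.assoc, g.act_hom]; simp⟩

@[ext]
theorem hom_ext {U U' : RightMod A} (f g : U ⟶ U') (h : f.hom = g.hom) : f = g := Hom.ext h

@[simp] theorem id_hom (U : RightMod A) : Hom.hom (𝟙 U) = 𝟙 U.X := rfl

@[simp] theorem comp_hom {U U' U'' : RightMod A} (f : U ⟶ U') (g : U' ⟶ U'') :
    Hom.hom (f ≫ g) = f.hom ≫ g.hom := rfl

section Preadditive

variable [Preadditive C] [MonoidalPreadditive C]

instance (U U' : RightMod A) : Zero (U ⟶ U') := ⟨⟨0, by simp⟩⟩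
instance (U U' : RightMod A) : Add (U ⟶ U') :=
  ⟨fun f g => ⟨f.hom + g.hom, by simp [f.act_hom, g.act_hom]⟩⟩
instance (U U' : RightMod A) : Neg (U ⟶ U') :=
  ⟨fun f => ⟨-f.hom, by
    have h : (-f.hom) ▷ A = -(f.hom ▷ A) :=
      eq_neg_of_add_eq_zero_left (by simp [← MonoidalPreadditive.add_whiskerRight])
    simp [f.act_hom, h]⟩⟩

@[simp] theorem zero_hom (U U' : RightMod A) : Hom.hom (0 : U ⟶ U') = 0 := rfl
@[simp] theorem add_hom {U U' : RightMod A} (f g : U ⟶ U') :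
    Hom.hom (f + g) = f.hom + g.hom := rfl
@[simp] theorem neg_hom {U U' : RightMod A} (f : U ⟶ U') : Hom.hom (-f) = -f.hom := rfl

instance (U U' : RightMod A) : AddCommGroup (U ⟶ U') where
  add_assoc f g h := by ext; simp [add_assoc]
  zero_add f := by ext; simp
  add_zero f := by ext; simp
  add_comm f g := by ext; simp [add_comm]
  neg_add_cancel f := by ext; simp
  nsmul := nsmulRec
  zsmul := zsmulRec

instance : Preadditive (RightMod A) where
  add_comp _ _ _ f f' g := by ext; simp
  comp_add _ _ _ f g g' := by ext; simp

variable {k : Type w} [Semiring k] [Linear k C] [MonoidalLinear k C]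

instance (U U' : RightMod A) : SMul k (U ⟶ U') :=
  ⟨fun r f => ⟨r • f.hom, by simp [f.act_hom]⟩⟩

@[simp] theorem smul_hom {U U' : RightMod A} (r : k) (f : U ⟶ U') :
    Hom.hom (r • f) = r • f.hom := rfl

instance (U U' : RightMod A) : Module k (U ⟶ U') where
  one_smul f := by ext; simp
  mul_smul r s f := by ext; simp [mul_smul]
  smul_zero r := by ext; simp
  smul_add r f g := by ext; simp
  add_smul r s f := by ext; simp [add_smul]
  zero_smul f := by ext; simp

instance : Linear k (RightMod A) where
  smul_comp _ _ _ r f g := by ext; simp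
  comp_smul _ _ _ f r g := by ext; simp

end Preadditive

/-- The right `A`-module `X ⊗ U`, for `X` in `C` and a right `A`-module `U`. -/
def tensorObj (X : C) (U : RightMod A) : RightMod A where
  X := X ⊗ U.X
  act := (α_ X U.X A).hom ≫ X ◁ U.act
  act_one := by
    have := congrArg (fun f => (α_ X U.X (𝟙_ C)).hom ≫ X ◁ f) U.act_one
    simpa using this
  act_mul := by
    have := congrArg (fun f => (α_ X U.X (A ⊗ A)).hom ≫ X ◁ f) U.act_mul
    simpa using this

/-- The isomorphism of right `A`-modules given by an isomorphism in `C` compatible with the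
actions. -/
def mkIso {U U' : RightMod A} (e : U.X ≅ U'.X) (h : U.act ≫ e.hom = e.hom ▷ A ≫ U'.act) :
    U ≅ U' where
  hom := ⟨e.hom, h⟩
  inv := ⟨e.inv, by
    rw [Iso.comp_inv_eq, Category.assoc, h, ← Category.assoc, ← comp_whiskerRight]; simp⟩
  hom_inv_id := by ext; simp
  inv_hom_id := by ext; simp

@[simp] theorem mkIso_hom_hom {U U' : RightMod A} (e : U.X ≅ U'.X)
    (h : U.act ≫ e.hom = e.hom ▷ A ≫ U'.act) : Hom.hom (mkIso e h).hom = e.hom := rfl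

@[simp] theorem mkIso_inv_hom {U U' : RightMod A} (e : U.X ≅ U'.X)
    (h : U.act ≫ e.hom = e.hom ▷ A ≫ U'.act) : Hom.hom (mkIso e h).inv = e.inv := rfl

/-- Right `A`-modules in `C` form a left module category over `C`. -/
instance : MonoidalLeftAction C (RightMod A) where
  actionObj X U := tensorObj X U
  actionHomLeft f U := ⟨f ▷ U.X, by simp [tensorObj, whisker_exchange]⟩
  actionHomRight X _ _ f := ⟨X ◁ f.hom, by
    simp [tensorObj, ← whiskerLeft_comp, f.act_hom]⟩
  actionAssocIso X Y U := mkIso (α_ X Y U.X) (by simp [tensorObj])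
  actionUnitIso U := mkIso (λ_ U.X) (by simp [tensorObj])
  actionHom_def _ _ := rfl
  actionHomRight_id _ _ := by ext; simp; rfl
  id_actionHomLeft _ _ := by ext; simp; rfl
  actionHom_comp {c c' c'' d d' d''} f₁ f₂ g₁ g₂ := by
    ext
    change (f₁ ≫ f₂) ▷ d.X ≫ c'' ◁ (g₁.hom ≫ g₂.hom) =
      (f₁ ▷ d.X ≫ c' ◁ g₁.hom) ≫ f₂ ▷ d'.X ≫ c'' ◁ g₂.hom
    simp [whisker_exchange_assoc]
  actionAssocIso_hom_naturality f g h := by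
    ext; simp [tensorObj, mkIso, MonoidalCategory.tensorHom_def]
  actionUnitIso_hom_naturality {d d'} f := by
    ext
    change (λ_ d.X).hom ≫ f.hom = 𝟙_ C ◁ f.hom ≫ (λ_ d'.X).hom
    simp
  whiskerLeft_actionHomLeft X _ _ f U := by ext; simp [tensorObj, mkIso]
  whiskerRight_actionHomLeft _ f U := by ext; simp [tensorObj, mkIso]
  associator_actionHom X Y Z U := by ext; simp [tensorObj, mkIso]
  leftUnitor_actionHom X U := by ext; simp [tensorObj, mkIso]
  rightUnitor_actionHom X U := by ext; simp [tensorObj, mkIso]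

end RightMod

end RightModules

/-- An algebra `A` in `C` is semisimple if the category of right `A`-modules in `C` is. -/
def IsSemisimpleAlg {C : Type u} [Category.{v} C] [MonoidalCategory C] [Preadditive C]
    [MonoidalPreadditive C] (A : C) [MonObj A] : Prop :=
  IsSemisimpleCat (RightMod A)

/-! ### Internal Hom -/

section InternalHoms

variable (C : Type u₁) [Category.{v₁} C] [MonoidalCategory C] {D : Type u₂} [Category.{v₂} D]
  [MonoidalLeftAction C D]

/-- An internal Hom from `M` to `V`: an object of `C` together with a representation by it of the
functor `X ↦ Hom (X ⊙ₗ M, V)`. -/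
structure InternalHom (M V : D) where
  obj : C
  repr : ((actionRight C M).op ⋙ yoneda.obj V).RepresentableBy obj

namespace InternalHom

variable {C}

/-- The natural bijection from `Hom (X ⊙ₗ M, V)` to `Hom (X, Hom(M, V))`. -/
def curry {M V : D} (h : InternalHom C M V) {X : C} (f : X ⊙ₗ M ⟶ V) : X ⟶ h.obj :=
  h.repr.homEquiv.symm f

/-- The evaluation morphism, corresponding to the identity of the internal Hom. -/
def ev {M V : D} (h : InternalHom C M V) : h.obj ⊙ₗ M ⟶ V :=
  h.repr.homEquiv (𝟙 h.obj)

theorem homEquiv_eq {M V : D} (h : InternalHom C M V) {X : C} (g : X ⟶ h.obj) :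
    h.repr.homEquiv g = g ⊵ₗ M ≫ h.ev :=
  h.repr.homEquiv_eq g

theorem curry_ev {M V : D} (h : InternalHom C M V) {X : C} (f : X ⊙ₗ M ⟶ V) :
    h.curry f ⊵ₗ M ≫ h.ev = f := by
  rw [← homEquiv_eq]; exact h.repr.homEquiv.apply_symm_apply f

theorem hom_ext {M V : D} (h : InternalHom C M V) {X : C} {f g : X ⟶ h.obj}
    (w : f ⊵ₗ M ≫ h.ev = g ⊵ₗ M ≫ h.ev) : f = g := by
  rw [← homEquiv_eq, ← homEquiv_eq] at w; exact h.repr.homEquiv.injective w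

/-- The composition `Hom(M₂, M₃) ⊗ Hom(M₁, M₂) ⟶ Hom(M₁, M₃)` of internal Homs. -/
def comp {M₁ M₂ M₃ : D} (h₂₃ : InternalHom C M₂ M₃) (h₁₂ : InternalHom C M₁ M₂)
    (h₁₃ : InternalHom C M₁ M₃) : h₂₃.obj ⊗ h₁₂.obj ⟶ h₁₃.obj :=
  h₁₃.curry ((αₗ h₂₃.obj h₁₂.obj M₁).hom ≫ h₂₃.obj ⊴ₗ h₁₂.ev ≫ h₂₃.ev)

theorem comp_ev {M₁ M₂ M₃ : D} (h₂₃ : InternalHom C M₂ M₃) (h₁₂ : InternalHom C M₁ M₂)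
    (h₁₃ : InternalHom C M₁ M₃) :
    comp h₂₃ h₁₂ h₁₃ ⊵ₗ M₁ ≫ h₁₃.ev =
      (αₗ h₂₃.obj h₁₂.obj M₁).hom ≫ h₂₃.obj ⊴ₗ h₁₂.ev ≫ h₂₃.ev :=
  curry_ev _ _

/-- The unit `𝟙_ C ⟶ Hom(M, M)`, corresponding to the identity of `M`. -/
def one {M : D} (h : InternalHom C M M) : 𝟙_ C ⟶ h.obj := h.curry (λₗ M).hom

theorem one_ev {M : D} (h : InternalHom C M M) : h.one ⊵ₗ M ≫ h.ev = (λₗ M).hom :=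
  curry_ev _ _

theorem comp_assoc {M₁ M₂ M₃ M₄ : D} (h₃₄ : InternalHom C M₃ M₄) (h₂₃ : InternalHom C M₂ M₃)
    (h₁₂ : InternalHom C M₁ M₂) (h₂₄ : InternalHom C M₂ M₄) (h₁₃ : InternalHom C M₁ M₃)
    (h₁₄ : InternalHom C M₁ M₄) :
    comp h₃₄ h₂₃ h₂₄ ▷ h₁₂.obj ≫ comp h₂₄ h₁₂ h₁₄ =
      (α_ h₃₄.obj h₂₃.obj h₁₂.obj).hom ≫ h₃₄.obj ◁ comp h₂₃ h₁₂ h₁₃ ≫ comp h₃₄ h₁₃ h₁₄ := by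
  apply hom_ext
  have e : comp h₃₄ h₂₃ h₂₄ ⊵ₗ (h₁₂.obj ⊙ₗ M₁) ≫ h₂₄.obj ⊴ₗ h₁₂.ev =
      (h₃₄.obj ⊗ h₂₃.obj) ⊴ₗ h₁₂.ev ≫ comp h₃₄ h₂₃ h₂₄ ⊵ₗ M₂ := (action_exchange _ _).symm
  have lhs : (comp h₃₄ h₂₃ h₂₄ ▷ h₁₂.obj ≫ comp h₂₄ h₁₂ h₁₄) ⊵ₗ M₁ ≫ h₁₄.ev =
      (αₗ (h₃₄.obj ⊗ h₂₃.obj) h₁₂.obj M₁).hom ≫ (h₃₄.obj ⊗ h₂₃.obj) ⊴ₗ h₁₂.ev ≫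
        (αₗ h₃₄.obj h₂₃.obj M₂).hom ≫ h₃₄.obj ⊴ₗ h₂₃.ev ≫ h₃₄.ev := by
    rw [comp_actionHomLeft, Category.assoc, comp_ev,
      MonoidalLeftAction.whiskerRight_actionHomLeft]
    simp only [Category.assoc, Iso.inv_hom_id_assoc]
    rw [← Category.assoc (comp h₃₄ h₂₃ h₂₄ ⊵ₗ (h₁₂.obj ⊙ₗ M₁)), e, Category.assoc, comp_ev]
  have rhs : ((α_ h₃₄.obj h₂₃.obj h₁₂.obj).hom ≫ h₃₄.obj ◁ comp h₂₃ h₁₂ h₁₃ ≫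
      comp h₃₄ h₁₃ h₁₄) ⊵ₗ M₁ ≫ h₁₄.ev =
      (α_ h₃₄.obj h₂₃.obj h₁₂.obj).hom ⊵ₗ M₁ ≫ (αₗ h₃₄.obj (h₂₃.obj ⊗ h₁₂.obj) M₁).hom ≫
        h₃₄.obj ⊴ₗ (αₗ h₂₃.obj h₁₂.obj M₁).hom ≫ h₃₄.obj ⊴ₗ h₂₃.obj ⊴ₗ h₁₂.ev ≫
        h₃₄.obj ⊴ₗ h₂₃.ev ≫ h₃₄.ev := by
    rw [comp_actionHomLeft, comp_actionHomLeft, Category.assoc, Category.assoc, comp_ev,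
      MonoidalLeftAction.whiskerLeft_actionHomLeft]
    simp only [Category.assoc, Iso.inv_hom_id_assoc]
    rw [← actionHomRight_comp_assoc, comp_ev]
    simp only [actionHomRight_comp, Category.assoc]
  rw [lhs, rhs, MonoidalLeftAction.associator_actionHom_assoc]
  simp

theorem one_comp {M V : D} (h : InternalHom C V V) (h' : InternalHom C M V) :
    h.one ▷ h'.obj ≫ comp h h' h' = (λ_ h'.obj).hom := by
  apply hom_ext
  have e : h.one ⊵ₗ (h'.obj ⊙ₗ M) ≫ h.obj ⊴ₗ h'.ev = 𝟙_ C ⊴ₗ h'.ev ≫ h.one ⊵ₗ V :=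
    (action_exchange _ _).symm
  rw [comp_actionHomLeft, Category.assoc, comp_ev,
    MonoidalLeftAction.whiskerRight_actionHomLeft]
  simp only [Category.assoc, Iso.inv_hom_id_assoc]
  rw [← Category.assoc (h.one ⊵ₗ (h'.obj ⊙ₗ M)), e, Category.assoc, one_ev]
  simp

theorem comp_one {M V : D} (h : InternalHom C M M) (h' : InternalHom C M V) :
    h'.obj ◁ h.one ≫ comp h' h h' = (ρ_ h'.obj).hom := by
  apply hom_ext
  rw [comp_actionHomLeft, Category.assoc, comp_ev,
    MonoidalLeftAction.whiskerLeft_actionHomLeft]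
  simp only [Category.assoc, Iso.inv_hom_id_assoc]
  rw [← actionHomRight_comp_assoc, one_ev]
  simp

/-- The algebra `Hom(M, M)` in `C`. -/
instance instMonObj {M : D} (h : InternalHom C M M) : MonObj h.obj where
  one := h.one
  mul := comp h h h
  one_mul := one_comp h h
  mul_one := comp_one h h
  mul_assoc := comp_assoc h h h h h h

/-- `M` is a left `Hom(M, M)`-module by evaluation. -/
instance instModObj {M : D} (h : InternalHom C M M) : ModObj h.obj M where
  smul := h.ev
  one_smul := one_ev h
  mul_smul := comp_ev h h h

/-- `Hom(M, V)` is a right `Hom(M, M)`-module by composition. -/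
def rightMod {M V : D} (h : InternalHom C M M) (h' : InternalHom C M V) : RightMod h.obj where
  X := h'.obj
  act := comp h' h h'
  act_one := comp_one h h'
  act_mul := by
    rw [comp_assoc h' h h h' h h']; simp; rfl

/-- The functor `F = Hom(M, -)` from `D` to right modules over `A = Hom(M, M)`. -/
def functor {M : D} (H : ∀ V : D, InternalHom C M V) : D ⥤ RightMod (H M).obj where
  obj V := rightMod (H M) (H V)
  map {V W} f := ⟨(H W).curry ((H V).ev ≫ f), by
    apply hom_ext
    have e := action_exchange ((H W).curry ((H V).ev ≫ f)) (H M).ev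
    simp only [rightMod, comp_actionHomLeft, Category.assoc, curry_ev, comp_ev,
      MonoidalLeftAction.whiskerRight_actionHomLeft, Iso.inv_hom_id_assoc]
    rw [← reassoc_of% e, curry_ev, ← Category.assoc, comp_ev]
    simp⟩
  map_id V := by
    ext
    apply hom_ext
    rw [curry_ev]
    simp [rightMod]
  map_comp f g := by
    ext
    apply hom_ext
    simp [rightMod, curry_ev, reassoc_of% (curry_ev)]

/-- The canonical morphism `X ⊗ Hom(M, V) ⟶ Hom(M, X ⊙ₗ V)`, corresponding to `X ⊙ₗ ev`. -/
def constraint (X : C) {M V : D} (h : InternalHom C M V) (h' : InternalHom C M (X ⊙ₗ V)) :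
    X ⊗ h.obj ⟶ h'.obj :=
  h'.curry ((αₗ X h.obj M).hom ≫ X ⊴ₗ h.ev)

theorem constraint_ev (X : C) {M V : D} (h : InternalHom C M V)
    (h' : InternalHom C M (X ⊙ₗ V)) :
    constraint X h h' ⊵ₗ M ≫ h'.ev = (αₗ X h.obj M).hom ≫ X ⊴ₗ h.ev :=
  curry_ev _ _

/-- The functor `Hom(M, -)` is a (lax) functor of `C`-module categories through the canonical
morphisms `X ⊗ Hom(M, V) ⟶ Hom(M, X ⊙ₗ V)`. -/
instance laxLeftLinear {M : D} (H : ∀ V : D, InternalHom C M V) :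
    (functor H).LaxLeftLinear C where
  μₗ X V := ⟨constraint X (H V) (H (X ⊙ₗ V)), by
    apply hom_ext
    have e := action_exchange (constraint X (H V) (H (X ⊙ₗ V))) (H M).ev
    have r : (constraint X (H V) (H (X ⊙ₗ V)) ▷ (H M).obj ≫
        comp (H (X ⊙ₗ V)) (H M) (H (X ⊙ₗ V))) ⊵ₗ M ≫ (H (X ⊙ₗ V)).ev =
        (αₗ (X ⊗ (H V).obj) (H M).obj M).hom ≫ (X ⊗ (H V).obj) ⊴ₗ (H M).ev ≫
          (αₗ X (H V).obj M).hom ≫ X ⊴ₗ (H V).ev := by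
      rw [comp_actionHomLeft, Category.assoc, comp_ev,
        MonoidalLeftAction.whiskerRight_actionHomLeft]
      simp only [Category.assoc, Iso.inv_hom_id_assoc]
      rw [← reassoc_of% e, constraint_ev]
    have l : (((α_ X (H V).obj (H M).obj).hom ≫ X ◁ comp (H V) (H M) (H V)) ≫
        constraint X (H V) (H (X ⊙ₗ V))) ⊵ₗ M ≫ (H (X ⊙ₗ V)).ev =
        (α_ X (H V).obj (H M).obj).hom ⊵ₗ M ≫ (αₗ X ((H V).obj ⊗ (H M).obj) M).hom ≫
          X ⊴ₗ (αₗ (H V).obj (H M).obj M).hom ≫ X ⊴ₗ (H V).obj ⊴ₗ (H M).ev ≫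
            X ⊴ₗ (H V).ev := by
      rw [comp_actionHomLeft, comp_actionHomLeft, Category.assoc, Category.assoc, constraint_ev,
        MonoidalLeftAction.whiskerLeft_actionHomLeft]
      simp only [Category.assoc, Iso.inv_hom_id_assoc]
      rw [← actionHomRight_comp, comp_ev]
      simp only [actionHomRight_comp]
    refine l.trans (Eq.trans ?_ r.symm)
    rw [MonoidalLeftAction.associator_actionHom_assoc]
    simp⟩
  μₗ_naturality_left {X X'} f V := by
    ext
    apply hom_ext
    change (f ▷ (H V).obj ≫ constraint X' (H V) (H (X' ⊙ₗ V))) ⊵ₗ M ≫ (H (X' ⊙ₗ V)).ev =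
      (constraint X (H V) (H (X ⊙ₗ V)) ≫ (H (X' ⊙ₗ V)).curry ((H (X ⊙ₗ V)).ev ≫ f ⊵ₗ V)) ⊵ₗ M ≫
        (H (X' ⊙ₗ V)).ev
    have e := action_exchange f (H V).ev
    rw [comp_actionHomLeft, comp_actionHomLeft, Category.assoc, Category.assoc, curry_ev,
      constraint_ev, ← Category.assoc (constraint X (H V) (H (X ⊙ₗ V)) ⊵ₗ M), constraint_ev,
      MonoidalLeftAction.whiskerRight_actionHomLeft]
    simp [e]
  μₗ_naturality_right X V W f := by
    ext
    apply hom_ext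
    change (X ◁ (H W).curry ((H V).ev ≫ f) ≫ constraint X (H W) (H (X ⊙ₗ W))) ⊵ₗ M ≫
        (H (X ⊙ₗ W)).ev =
      (constraint X (H V) (H (X ⊙ₗ V)) ≫ (H (X ⊙ₗ W)).curry ((H (X ⊙ₗ V)).ev ≫ X ⊴ₗ f)) ⊵ₗ M ≫
        (H (X ⊙ₗ W)).ev
    rw [comp_actionHomLeft, comp_actionHomLeft, Category.assoc, Category.assoc, curry_ev,
      constraint_ev, ← Category.assoc (constraint X (H V) (H (X ⊙ₗ V)) ⊵ₗ M), constraint_ev,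
      MonoidalLeftAction.whiskerLeft_actionHomLeft]
    simp only [Category.assoc, Iso.inv_hom_id_assoc]
    rw [← actionHomRight_comp, curry_ev, actionHomRight_comp]
  μₗ_associativity X Y V := by
    ext
    apply hom_ext
    change (constraint (X ⊗ Y) (H V) (H ((X ⊗ Y) ⊙ₗ V)) ≫
        (H (X ⊙ₗ Y ⊙ₗ V)).curry ((H ((X ⊗ Y) ⊙ₗ V)).ev ≫ (αₗ X Y V).hom)) ⊵ₗ M ≫
          (H (X ⊙ₗ Y ⊙ₗ V)).ev =
      ((α_ X Y (H V).obj).hom ≫ X ◁ constraint Y (H V) (H (Y ⊙ₗ V)) ≫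
        constraint X (H (Y ⊙ₗ V)) (H (X ⊙ₗ Y ⊙ₗ V))) ⊵ₗ M ≫ (H (X ⊙ₗ Y ⊙ₗ V)).ev
    simp only [comp_actionHomLeft, Category.assoc, curry_ev, constraint_ev,
      MonoidalLeftAction.whiskerLeft_actionHomLeft, Iso.inv_hom_id_assoc]
    rw [← Category.assoc, constraint_ev, ← actionHomRight_comp, constraint_ev,
      actionHomRight_comp, MonoidalLeftAction.associator_actionHom_assoc]
    simp
  μₗ_unitality V := by
    ext
    apply hom_ext
    change (λ_ (H V).obj).hom ⊵ₗ M ≫ (H V).ev =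
      (constraint (𝟙_ C) (H V) (H (𝟙_ C ⊙ₗ V)) ≫
        (H V).curry ((H (𝟙_ C ⊙ₗ V)).ev ≫ (λₗ V).hom)) ⊵ₗ M ≫ (H V).ev
    rw [comp_actionHomLeft, Category.assoc, curry_ev, ← Category.assoc, constraint_ev]
    simp

end InternalHom

end InternalHoms

/-! ### The tensor product over an algebra -/

section TensorOver

variable {C : Type u₁} [Category.{v₁} C] [MonoidalCategory C] {D : Type u₂} [Category.{v₂} D]
  [MonoidalLeftAction C D] [HasCoequalizers D]

/-- `U ⊗_A M` for a right `A`-module `U` in `C` and a left `A`-module `M` in the `C`-module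
category `D`: the coequalizer of the two actions `(U ⊗ A) ⊙ₗ M ⟶ U ⊙ₗ M`. -/
noncomputable def tensorOver {A : C} [MonObj A] (U : RightMod A) (M : D) [ModObj A M] : D :=
  coequalizer (U.act ⊵ₗ M) ((αₗ U.X A M).hom ≫ U.X ⊴ₗ ModObj.smul (M := A) (X := M))

/-- The projection `U ⊙ₗ M ⟶ U ⊗_A M`. -/
noncomputable def tensorOverπ {A : C} [MonObj A] (U : RightMod A) (M : D) [ModObj A M] :
    U.X ⊙ₗ M ⟶ tensorOver U M :=
  coequalizer.π _ _

theorem tensorOver_condition {A : C} [MonObj A] (U : RightMod A) (M : D) [ModObj A M] :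
    U.act ⊵ₗ M ≫ tensorOverπ U M =
      (αₗ U.X A M).hom ≫ U.X ⊴ₗ ModObj.smul (M := A) (X := M) ≫ tensorOverπ U M :=
  (coequalizer.condition _ _).trans (Category.assoc _ _ _)

theorem tensorOver_hom_ext {A : C} [MonObj A] {U : RightMod A} {M : D} [ModObj A M] {V : D}
    {f g : tensorOver U M ⟶ V} (w : tensorOverπ U M ≫ f = tensorOverπ U M ≫ g) : f = g :=
  coequalizer.hom_ext w

/-- The morphism `f ⊗_A M : U ⊗_A M ⟶ U' ⊗_A M` induced by `f : U ⟶ U'`. -/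
noncomputable def tensorOverMap {A : C} [MonObj A] {U U' : RightMod A} (f : U ⟶ U') (M : D)
    [ModObj A M] : tensorOver U M ⟶ tensorOver U' M :=
  coequalizer.desc (f.hom ⊵ₗ M ≫ tensorOverπ U' M) (by
    have e := action_exchange f.hom (ModObj.smul (M := A) (X := M))
    rw [← Category.assoc, ← comp_actionHomLeft, f.act_hom, comp_actionHomLeft, Category.assoc,
      tensorOver_condition, MonoidalLeftAction.whiskerRight_actionHomLeft]
    simp only [Category.assoc, Iso.inv_hom_id_assoc]
    rw [reassoc_of% e])

theorem tensorOverπ_map {A : C} [MonObj A] {U U' : RightMod A} (f : U ⟶ U') (M : D)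
    [ModObj A M] : tensorOverπ U M ≫ tensorOverMap f M = f.hom ⊵ₗ M ≫ tensorOverπ U' M :=
  coequalizer.π_desc _ _

/-- The functor `G = - ⊗_A M` from right `A`-modules in `C` to `D`. -/
noncomputable def tensorOverFunctor (A : C) [MonObj A] (M : D) [ModObj A M] :
    RightMod A ⥤ D where
  obj U := tensorOver U M
  map f := tensorOverMap f M
  map_id U := by
    apply tensorOver_hom_ext
    simp [tensorOverπ_map]
  map_comp f g := by
    apply tensorOver_hom_ext
    rw [tensorOverπ_map, ← Category.assoc, tensorOverπ_map, Category.assoc, tensorOverπ_map]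
    simp

end TensorOver

end FusionModule

/-! Write `F = Hom(M, -)` and `G = - ⊗_A M`. Evaluation induces a counit `G F V ⟶ V`, and the
projection `U ⊙ₗ M ⟶ U ⊗_A M` induces a unit `U ⟶ F G U`. The theorem follows once both are shown to
be invertible.

Internal Homs exist because a functor `Hom (L -, V)` on a semisimple category with finitely many
simple objects, with finite-dimensional values, is representable (`exists_representableBy`). Duals
in `C` make `X ⊗ Hom(M, V) ⟶ Hom(M, X ⊙ₗ V)` invertible (`InternalHom.isIso_constraint`); for `V =
M` this says that `F` sends `X ⊙ₗ M` to the free module `X ⊗ A`.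

The core is `InternalHom.isIso_tensorUnitHom`. A module `U` is the coequalizer of `(U ⊗ A) ⊗ A ⇉ U ⊗
A`, and this pair is, up to the isomorphisms just mentioned, the image under `F` of the pair that
defines `U ⊗_A M`. Semisimplicity of `D` splits the latter coequalizer by equations that any
additive functor preserves, so no exactness of `F` has to be proved beforehand.

The generator hypothesis makes evaluations epic, hence `F` faithful; a triangle identity and
faithfulness then give invertibility of the counit. Abelianness, semisimplicity and simple objects
are carried from `D` to `A`-modules along the equivalence. -/

namespace FusionModule

universe w v v₁ v₂ u u₁ u₂

/-! ### Splittings in semisimple abelian categories -/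

section Semisimple

/-- The identity of a semisimple object is a sum of endomorphisms factoring through simple
objects. -/
theorem IsSemisimpleObj.exists_sum_eq_id {C : Type u} [Category.{v} C] [Preadditive C] {X : C}
    (hX : IsSemisimpleObj X) :
    ∃ (n : ℕ) (S : Fin n → C) (p : ∀ i, X ⟶ S i) (j : ∀ i, S i ⟶ X),
      (∀ i, Simple (S i)) ∧ ∑ i, p i ≫ j i = 𝟙 X := by
  obtain ⟨n, S, b, hS, ⟨hb⟩, ⟨e⟩⟩ := hX
  refine ⟨n, S, fun i => e.inv ≫ b.π i, fun i => b.ι i ≫ e.hom, hS, ?_⟩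
  have h := congrArg (fun f => e.inv ≫ f ≫ e.hom) (IsBilimit.total hb)
  simpa [Preadditive.comp_sum, Preadditive.sum_comp] using h

variable {C : Type u} [Category.{v} C] [Abelian C]

/-- Some simple summand of `X` maps to `S` by a nonzero morphism, which is invertible by Schur's
lemma; its inverse gives the section. -/
theorem exists_section_of_epi_of_simple {X S : C} (hX : IsSemisimpleObj X) [Simple S]
    (g : X ⟶ S) [Epi g] : ∃ s : S ⟶ X, s ≫ g = 𝟙 S := by
  obtain ⟨n, T, p, j, hT, h⟩ := hX.exists_sum_eq_id
  have hg : g ≠ 0 := fun h0 => id_nonzero S ((cancel_epi g).1 (by simp [h0]))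
  obtain ⟨i, hi⟩ : ∃ i, j i ≫ g ≠ 0 := by
    by_contra! H
    apply hg
    rw [← Category.id_comp g, ← h]
    simp [Preadditive.sum_comp, H]
  have := hT i
  have := isIso_of_hom_simple hi
  exact ⟨inv (j i ≫ g) ≫ j i, by simp⟩

/-- The pullback of an epimorphism along a morphism from `S` is an epimorphism onto `S`, hence
split; the section yields the lift. -/
theorem projective_of_simple (hC : ∀ X : C, IsSemisimpleObj X) (S : C) [Simple S] :
    Projective S where
  factors {E Z} f e _ := by
    obtain ⟨s, hs⟩ := exists_section_of_epi_of_simple (hC (pullback f e)) (pullback.fst f e)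
    exact ⟨s ≫ pullback.snd f e, by
      rw [Category.assoc, ← pullback.condition, reassoc_of% hs]⟩

theorem projective_of_isSemisimpleObj (hC : ∀ X : C, IsSemisimpleObj X) (X : C) :
    Projective X where
  factors {E Z} f e _ := by
    obtain ⟨n, T, p, j, hT, h⟩ := (hC X).exists_sum_eq_id
    have := fun i => projective_of_simple hC (T i)
    refine ⟨∑ i, p i ≫ Projective.factorThru (j i ≫ f) e, ?_⟩
    simp only [Preadditive.sum_comp, Category.assoc, Projective.factorThru_comp]
    simp only [← Category.assoc, ← Preadditive.sum_comp, h, Category.id_comp]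

theorem exists_section_of_epi (hC : ∀ X : C, IsSemisimpleObj X) {X Y : C} (g : X ⟶ Y) [Epi g] :
    ∃ s : Y ⟶ X, s ≫ g = 𝟙 Y := by
  have := projective_of_isSemisimpleObj hC Y
  exact ⟨Projective.factorThru (𝟙 Y) g, by simp⟩

/-- In a semisimple category a morphism killed by the cokernel projection of `f` factors
through `f`. -/
theorem exists_comp_eq_of_comp_cokernel (hC : ∀ X : C, IsSemisimpleObj X) {X Y Z : C}
    (f : X ⟶ Y) (g : Z ⟶ Y) (hg : g ≫ cokernel.π f = 0) : ∃ t : Z ⟶ X, t ≫ f = g := by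
  have := projective_of_isSemisimpleObj hC Z
  -- The image of `f` is the kernel of its cokernel projection, so `g` lands in it and lifts by
  -- projectivity of `Z`.
  refine ⟨Projective.factorThru (kernel.lift _ g hg) (Abelian.factorThruImage f), ?_⟩
  have h := congrArg (· ≫ Abelian.image.ι f)
    (Projective.factorThru_comp (kernel.lift _ g hg) (Abelian.factorThruImage f))
  simp only [Category.assoc, Abelian.image.fac] at h
  rw [h]
  exact kernel.lift_ι _ _ _

/-- Every morphism of a semisimple category has a pseudo-inverse. -/
theorem exists_pseudoInverse (hC : ∀ X : C, IsSemisimpleObj X) {X Y : C} (f : X ⟶ Y) :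
    ∃ r : Y ⟶ X, f ≫ r ≫ f = f := by
  obtain ⟨s, hs⟩ := exists_section_of_epi hC (cokernel.π f)
  obtain ⟨r, hr⟩ := exists_comp_eq_of_comp_cokernel hC f (𝟙 Y - cokernel.π f ≫ s)
    (by simp [hs])
  exact ⟨r, by simp [hr]⟩

/-- A coequalizer in a semisimple category is split. -/
theorem exists_splitting_of_coequalizer (hC : ∀ X : C, IsSemisimpleObj X) {X Y : C}
    (f g : X ⟶ Y) : ∃ (s : coequalizer f g ⟶ Y) (t : Y ⟶ X),
      s ≫ coequalizer.π f g = 𝟙 _ ∧ 𝟙 Y - coequalizer.π f g ≫ s = t ≫ (f - g) := by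
  obtain ⟨s, hs⟩ := exists_section_of_epi hC (coequalizer.π f g)
  -- The cokernel projection of `f - g` factors through the coequalizer, so it kills `𝟙 - π ≫ s`,
  -- which therefore factors through `f - g`.
  have h : coequalizer.π f g ≫ coequalizer.desc (cokernel.π (f - g))
      (by rw [← sub_eq_zero, ← Preadditive.sub_comp, cokernel.condition]) =
      cokernel.π (f - g) := coequalizer.π_desc _ _
  obtain ⟨t, ht⟩ := exists_comp_eq_of_comp_cokernel hC (f - g) (𝟙 Y - coequalizer.π f g ≫ s)
    (by rw [← h, ← Category.assoc, Preadditive.sub_comp, Category.assoc, hs]; simp)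
  exact ⟨s, t, hs, ht.symm⟩

end Semisimple

/-! ### Representability over a category with finitely many simple objects -/

section Representability

variable {k : Type w} [Field k] {C : Type u₁} [Category.{v₁} C] [Abelian C] [Linear k C]
  {D : Type u₂} [Category.{v₂} D] [Preadditive D] [Linear k D]

/-- A family of subspaces `R X` of `Hom (L X, V)` stable under precomposition has a weakly
universal element. -/
theorem exists_weaklyUniversal (hC : ∀ X : C, IsSemisimpleObj X)
    (hS : ∃ (n : ℕ) (S : Fin n → C), ∀ X : C, Simple X → ∃ i, Nonempty (X ≅ S i))
    (L : C ⥤ D) [L.Additive] [L.Linear k] (V : D) [∀ X, Module.Finite k (L.obj X ⟶ V)]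
    (R : ∀ X, Submodule k (L.obj X ⟶ V))
    (hR : ∀ {X Y : C} (f : X ⟶ Y), ∀ x ∈ R Y, L.map f ≫ x ∈ R X) :
    ∃ (P : C) (p : L.obj P ⟶ V), p ∈ R P ∧ ∀ (X : C), ∀ x ∈ R X, ∃ f : X ⟶ P,
      L.map f ≫ p = x := by
  classical
  have := Abelian.hasFiniteBiproducts (C := C)
  obtain ⟨n, S, hS⟩ := hS
  -- The weakly universal object contains one copy of `S i` for each vector of a basis of `R (S i)`,
  -- and `p` restricts to that vector on the copy.
  let J := Σ i : Fin n, Fin (Module.finrank k (R (S i)))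
  let b : ∀ i, Module.Basis (Fin (Module.finrank k (R (S i)))) k (R (S i)) :=
    fun i => Module.finBasis k (R (S i))
  let T : J → C := fun a => S a.1
  let x₀ : ∀ a : J, L.obj (T a) ⟶ V := fun a => (b a.1 a.2 : L.obj (S a.1) ⟶ V)
  let p : L.obj (⨁ T) ⟶ V := ∑ a, L.map (biproduct.π T a) ≫ x₀ a
  have hp : ∀ a, L.map (biproduct.ι T a) ≫ p = x₀ a := by
    intro a
    simp only [p, Preadditive.comp_sum, ← Category.assoc, ← L.map_comp]
    rw [Finset.sum_eq_single a]
    · simp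
    · intro c _ hc
      rw [biproduct.ι_π_ne _ hc.symm]
      simp
    · simp
  have simple : ∀ X : C, Simple X → ∀ x ∈ R X, ∃ f : X ⟶ ⨁ T, L.map f ≫ p = x := by
    intro X hX x hx
    obtain ⟨i, ⟨e⟩⟩ := hS X hX
    let y : R (S i) := ⟨L.map e.inv ≫ x, hR _ _ hx⟩
    have hy : ∑ j, (b i).repr y j • x₀ ⟨i, j⟩ = L.map e.inv ≫ x := by
      have h := congrArg (R (S i)).subtype ((b i).sum_repr y)
      rw [map_sum] at h
      simp only [map_smul] at h
      exact h
    refine ⟨e.hom ≫ ∑ j, (b i).repr y j • biproduct.ι T ⟨i, j⟩, ?_⟩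
    rw [L.map_comp, L.map_sum, Category.assoc, Preadditive.sum_comp]
    simp only [L.map_smul, Linear.smul_comp, hp]
    rw [hy, ← Category.assoc, ← L.map_comp]
    simp
  refine ⟨⨁ T, p, Submodule.sum_mem _ fun a _ => hR _ _ (b a.1 a.2).2, fun X x hx => ?_⟩
  obtain ⟨m, U, q, j, hU, h⟩ := (hC X).exists_sum_eq_id
  choose f hf using fun a => simple (U a) (hU a) (L.map (j a) ≫ x) (hR _ _ hx)
  refine ⟨∑ a, q a ≫ f a, ?_⟩
  simp only [L.map_sum, Preadditive.sum_comp, L.map_comp, Category.assoc, hf]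
  simp only [← Category.assoc, ← L.map_comp, ← Preadditive.sum_comp, ← L.map_sum, h]
  simp

/-- On a semisimple category with finitely many simple objects the functors `Hom (L -, V)` with
finite-dimensional values are representable. -/
theorem exists_representableBy [∀ X Y : C, Module.Finite k (X ⟶ Y)]
    (hC : ∀ X : C, IsSemisimpleObj X)
    (hS : ∃ (n : ℕ) (S : Fin n → C), ∀ X : C, Simple X → ∃ i, Nonempty (X ≅ S i))
    (L : C ⥤ D) [L.Additive] [L.Linear k] (V : D) [∀ X, Module.Finite k (L.obj X ⟶ V)] :
    ∃ P : C, Nonempty ((L.op ⋙ yoneda.obj V).RepresentableBy P) := by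
  -- `p` makes `Hom (X, P) ⟶ Hom (L X, V)` surjective. Its kernel `R` is a subfunctor of `Hom (-,
  -- P)`, to which the same lemma applies with `L` the identity: `R X` consists of the morphisms
  -- factoring through some `q : Q ⟶ P`.
  obtain ⟨P, p, -, hP⟩ := exists_weaklyUniversal (k := k) hC hS L V (fun _ => ⊤)
    (fun _ _ _ => trivial)
  let R : ∀ X, Submodule k (X ⟶ P) := fun X =>
    { carrier := {f | L.map f ≫ p = 0}
      zero_mem' := by simp
      add_mem' := fun {f g} hf hg => by
        change L.map f ≫ p = 0 at hf
        change L.map g ≫ p = 0 at hg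
        change L.map (f + g) ≫ p = 0
        rw [L.map_add, Preadditive.add_comp, hf, hg, add_zero]
      smul_mem' := fun r f hf => by
        change L.map f ≫ p = 0 at hf
        change L.map (r • f) ≫ p = 0
        rw [L.map_smul, Linear.smul_comp, hf, smul_zero] }
  have memR : ∀ {X} (f : X ⟶ P), f ∈ R X ↔ L.map f ≫ p = 0 := fun f => Iff.rfl
  obtain ⟨Q, q, hq, hQ⟩ := exists_weaklyUniversal (k := k) hC hS (𝟭 C) P R (by
    intro X Y f x hx
    rw [memR] at hx ⊢
    simp [hx])
  replace hQ : ∀ {X} (f : X ⟶ P), L.map f ≫ p = 0 → ∃ t : X ⟶ Q, t ≫ q = f := fun f hf => hQ _ f hf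
  change Q ⟶ P at q
  replace hq : L.map q ≫ p = 0 := hq
  -- `r ≫ q` is an idempotent projecting `P` onto the image of `q`. Splitting the complementary
  -- idempotent leaves a summand `P'` on which the surjection is also injective.
  obtain ⟨r, hr⟩ := exists_pseudoInverse hC q
  obtain ⟨P', i, s, his, hsi⟩ := IsIdempotentComplete.idempotents_split P (𝟙 P - r ≫ q)
    (by simp [hr])
  have hqs : q ≫ s = 0 := by
    have : (q ≫ s) ≫ i = 0 := by rw [Category.assoc, hsi]; simp [hr]
    rw [← Category.comp_id (q ≫ s), ← his, ← Category.assoc, this, zero_comp]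
  have hp : L.map s ≫ L.map i ≫ p = p := by
    rw [← Category.assoc, ← L.map_comp, hsi, L.map_sub, Preadditive.sub_comp, L.map_comp,
      Category.assoc, hq]
    simp
  have bij : ∀ X : C, Function.Bijective (fun f : X ⟶ P' => L.map f ≫ L.map i ≫ p) := by
    intro X
    constructor
    · intro f g hfg
      obtain ⟨t, ht⟩ := hQ ((f - g) ≫ i) (by
        rw [L.map_comp, L.map_sub, Category.assoc, Preadditive.sub_comp]
        exact sub_eq_zero.2 hfg)
      have : f - g = 0 := by
        rw [← Category.comp_id (f - g), ← his, ← Category.assoc, ← ht, Category.assoc, hqs,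
          comp_zero]
      exact sub_eq_zero.1 this
    · intro x
      obtain ⟨f, hf⟩ := hP X x trivial
      exact ⟨f ≫ s, by simpa [hp] using hf⟩
  exact ⟨P', ⟨{
    homEquiv := Equiv.ofBijective _ (bij _)
    homEquiv_comp := fun f g => by simp }⟩⟩

end Representability

theorem nonempty_internalHom {k : Type w} [Field k] {C : Type u₁} [Category.{v₁} C] [Abelian C]
    [Linear k C] [MonoidalCategory C] [MonoidalPreadditive C] [MonoidalLinear k C]
    (hC : IsFusionCat k C) {D : Type u₂} [Category.{v₂} D] [Abelian D] [Linear k D]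
    [MonoidalLeftAction C D] (hD : IsSemisimpleModuleCat k C D) (N V : D) :
    Nonempty (InternalHom C N V) := by
  have := hC.finite_hom
  have := hD.finite_hom
  have : (actionRight C N).Additive := ⟨fun {_ _ f g} => hD.add_left f g N⟩
  have : (actionRight C N).Linear k := ⟨fun {_ _} f r => hD.smul_left r f N⟩
  obtain ⟨P, ⟨h⟩⟩ := exists_representableBy (k := k) hC.semisimple.semisimple hC.finite_simple
    (actionRight C N) V
  exact ⟨⟨P, h⟩⟩

/-! ### The adjunction between the actions of dual objects -/

section Duality

variable {C : Type u₁} [Category.{v₁} C] [MonoidalCategory C] {D : Type u₂} [Category.{v₂} D]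
  [MonoidalLeftAction C D] (X Y : C) [ExactPairing X Y]

/-- The unit `W ⟶ X ⊙ₗ Y ⊙ₗ W` of the adjunction between the actions of dual objects. -/
def actionCoev (W : D) : W ⟶ X ⊙ₗ Y ⊙ₗ W :=
  (λₗ W).inv ≫ η_ X Y ⊵ₗ W ≫ (αₗ X Y W).hom

/-- The counit `Y ⊙ₗ X ⊙ₗ W ⟶ W` of the adjunction between the actions of dual objects. -/
def actionEv (W : D) : Y ⊙ₗ X ⊙ₗ W ⟶ W :=
  (αₗ Y X W).inv ≫ ε_ X Y ⊵ₗ W ≫ (λₗ W).hom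

theorem actionCoev_naturality {W W' : D} (f : W ⟶ W') :
    f ≫ actionCoev X Y W' = actionCoev X Y W ≫ X ⊴ₗ Y ⊴ₗ f := by
  have e := action_exchange (η_ X Y) f
  rw [unit_actionHomRight] at e
  simp only [Category.assoc] at e
  rw [actionCoev, actionCoev, ← cancel_epi (λₗ[C] W).hom, reassoc_of% e]
  simp

theorem actionEv_naturality {W W' : D} (f : W ⟶ W') :
    Y ⊴ₗ X ⊴ₗ f ≫ actionEv X Y W' = actionEv X Y W ≫ f := by
  have e := action_exchange (ε_ X Y) f
  rw [unit_actionHomRight] at e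
  have e' := congrArg (fun t => (αₗ Y X W).inv ≫ t ≫ (λₗ W').hom) e
  simpa [actionEv] using e'

/-- This is the zigzag identity of the exact pairing, acting on `W`; the rest is coherence of the
action. -/
theorem actionCoev_actionEv (W : D) :
    actionCoev X Y (X ⊙ₗ W) ≫ X ⊴ₗ actionEv X Y W = 𝟙 (X ⊙ₗ W) := by
  have zig := congrArg (fun t => (λₗ (X ⊙ₗ W)).inv ≫ (αₗ (𝟙_ C) X W).inv ≫ t ⊵ₗ W)
    (ExactPairing.evaluation_coevaluation X Y)
  have pent : (αₗ (X ⊗ Y) X W).hom ≫ (αₗ X Y (X ⊙ₗ W)).hom ≫ X ⊴ₗ (αₗ Y X W).inv =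
      (α_ X Y X).hom ⊵ₗ W ≫ (αₗ X (Y ⊗ X) W).hom := by
    rw [← MonoidalLeftAction.associator_actionHom_assoc]
    simp
  have hρ : (ρ_ X).inv ⊵ₗ W ≫ (αₗ X (𝟙_ C) W).hom ≫ X ⊴ₗ (λₗ W).hom = 𝟙 _ := by
    rw [← MonoidalLeftAction.rightUnitor_actionHom, inv_hom_actionHomLeft]
  have zig' := congrArg (· ≫ (αₗ X (𝟙_ C) W).hom ≫ X ⊴ₗ (λₗ W).hom) zig
  simp only [comp_actionHomLeft, Category.assoc, hρ] at zig'
  rw [MonoidalLeftAction.leftUnitor_actionHom] at zig'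
  simp only [MonoidalLeftAction.whiskerLeft_actionHomLeft, Category.assoc,
    Iso.inv_hom_id_assoc] at zig'
  rw [actionCoev, actionEv, actionHomLeft_action]
  simp only [Category.assoc, actionHomRight_comp]
  rw [reassoc_of% pent]
  simpa using zig'

/-- On the left the unit is that of `C` acting on itself. This lemma and the next one pass between
the adjunction in `C` and the one in `D`. -/
theorem actionCoev_actionHomLeft (Z : C) (W : D) :
    actionCoev X Y Z ⊵ₗ W ≫ (αₗ X (Y ⊗ Z) W).hom ≫ X ⊴ₗ (αₗ Y Z W).hom =
      actionCoev X Y (Z ⊙ₗ W) := by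
  have hl : (λ_ Z).inv ⊵ₗ W = (λₗ (Z ⊙ₗ W)).inv ≫ (αₗ (𝟙_ C) Z W).inv := by
    rw [← cancel_mono ((λ_ Z).hom ⊵ₗ W), inv_hom_actionHomLeft]
    simp
  change ((λ_ Z).inv ≫ η_ X Y ▷ Z ≫ (α_ X Y Z).hom) ⊵ₗ W ≫ _ = _
  simp only [comp_actionHomLeft, Category.assoc, MonoidalLeftAction.associator_actionHom, hl,
    actionCoev, actionHomLeft_action]

theorem actionEv_actionHomLeft (Z : C) (W : D) :
    actionEv X Y Z ⊵ₗ W =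
      (αₗ Y (X ⊗ Z) W).hom ≫ Y ⊴ₗ (αₗ X Z W).hom ≫ actionEv X Y (Z ⊙ₗ W) := by
  have ha : (αₗ Y (X ⊗ Z) W).hom ≫ Y ⊴ₗ (αₗ X Z W).hom =
      (α_ Y X Z).inv ⊵ₗ W ≫ (αₗ (Y ⊗ X) Z W).hom ≫ (αₗ Y X (Z ⊙ₗ W)).hom := by
    rw [← MonoidalLeftAction.associator_actionHom, inv_hom_actionHomLeft_assoc]
  change ((α_ Y X Z).inv ≫ ε_ X Y ▷ Z ≫ (λ_ Z).hom) ⊵ₗ W = _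
  rw [reassoc_of% ha, actionEv]
  simp [-actionHomLeft_action, MonoidalLeftAction.whiskerRight_actionHomLeft]

end Duality

/-! ### Internal Homs commute with the action of dualizable objects -/

namespace InternalHom

variable {C : Type u₁} [Category.{v₁} C] [MonoidalCategory C] {D : Type u₂} [Category.{v₂} D]
  [MonoidalLeftAction C D]

/-- For an object with a right dual the canonical morphism `X ⊗ Hom(M, V) ⟶ Hom(M, X ⊙ₗ V)` is
an isomorphism. -/
theorem isIso_constraint (X Y : C) [ExactPairing X Y] {M V : D} (h : InternalHom C M V)
    (h' : InternalHom C M (X ⊙ₗ V)) : IsIso (constraint X h h') := by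
  -- `κ` is the transpose, under the adjunction of `Y ⊗ -` (left) with `X ⊗ -` (right), of the
  -- inverse being constructed.
  let κ : Y ⊗ h'.obj ⟶ h.obj :=
    h.curry ((αₗ Y h'.obj M).hom ≫ Y ⊴ₗ h'.ev ≫ actionEv X Y V)
  have hκ : κ ⊵ₗ M ≫ h.ev = (αₗ Y h'.obj M).hom ≫ Y ⊴ₗ h'.ev ≫ actionEv X Y V := curry_ev _ _
  have hc := constraint_ev X h h'
  set c := constraint X h h'
  have h₁ : Y ◁ c ≫ κ = actionEv X Y h.obj := by
    apply h.hom_ext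
    rw [comp_actionHomLeft, Category.assoc, hκ, actionEv_actionHomLeft,
      MonoidalLeftAction.whiskerLeft_actionHomLeft]
    simp only [Category.assoc, Iso.inv_hom_id_assoc]
    rw [← actionHomRight_comp_assoc, hc, actionHomRight_comp_assoc, actionEv_naturality]
  refine ⟨(actionCoev X Y h'.obj : h'.obj ⟶ X ⊗ Y ⊗ h'.obj) ≫ X ◁ κ, ?_, ?_⟩
  · have e : c ≫ actionCoev X Y h'.obj = actionCoev X Y (X ⊗ h.obj) ≫ X ◁ Y ◁ c :=
      actionCoev_naturality X Y c
    have z : actionCoev X Y (X ⊗ h.obj) ≫ X ◁ actionEv X Y h.obj = 𝟙 (X ⊗ h.obj) :=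
      actionCoev_actionEv X Y h.obj
    refine (Category.assoc _ _ _).symm.trans ?_
    refine (congrArg (· ≫ X ◁ κ) e).trans ?_
    refine (Category.assoc _ _ _).trans ?_
    rw [← whiskerLeft_comp, h₁]
    exact z
  · apply h'.hom_ext
    rw [comp_actionHomLeft, comp_actionHomLeft, Category.assoc, Category.assoc, hc,
      MonoidalLeftAction.whiskerLeft_actionHomLeft]
    simp only [Category.assoc, Iso.inv_hom_id_assoc]
    rw [← actionHomRight_comp, hκ, actionHomRight_comp, actionHomRight_comp]
    have e := actionCoev_actionHomLeft X Y h'.obj M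
    have e' := reassoc_of% e
    refine (e' _).trans ?_
    rw [← Category.assoc, ← actionCoev_naturality, Category.assoc, actionCoev_actionEv]
    simp

end InternalHom

/-! ### The functor `Hom(M, -)`: compatibilities, faithfulness, linearity -/

namespace InternalHom

section Functor

variable {C : Type u₁} [Category.{v₁} C] [MonoidalCategory C] {D : Type u₂} [Category.{v₂} D]
  [MonoidalLeftAction C D] {M : D} (H : ∀ V : D, InternalHom C M V)

/-- The morphism `Hom(M, V) ⟶ Hom(M, W)` given by composition with `f : V ⟶ W`. -/
def mapHom {V W : D} (f : V ⟶ W) : (H V).obj ⟶ (H W).obj :=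
  (H W).curry ((H V).ev ≫ f)

theorem mapHom_ev {V W : D} (f : V ⟶ W) : mapHom H f ⊵ₗ M ≫ (H W).ev = (H V).ev ≫ f :=
  curry_ev _ _

theorem mapHom_id (V : D) : mapHom H (𝟙 V) = 𝟙 (H V).obj :=
  congrArg RightMod.Hom.hom ((functor H).map_id V)

theorem mapHom_comp {V W Z : D} (f : V ⟶ W) (g : W ⟶ Z) :
    mapHom H (f ≫ g) = mapHom H f ≫ mapHom H g :=
  congrArg RightMod.Hom.hom ((functor H).map_comp f g)

theorem constraint_mapHom_actionHomLeft {X Y : C} (f : X ⟶ Y) (V : D) :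
    constraint X (H V) (H (X ⊙ₗ V)) ≫ mapHom H (f ⊵ₗ V) =
      f ▷ (H V).obj ≫ constraint Y (H V) (H (Y ⊙ₗ V)) :=
  (congrArg RightMod.Hom.hom
    (Functor.LaxLeftLinear.μₗ_naturality_left (F := functor H) f V)).symm

/-- With `constraint_mapHom_actionHomLeft`, this identifies the image under `Hom(M, -)` of the pair
defining `U ⊗_A M` with the pair `(U ⊗ A) ⊗ A ⇉ U ⊗ A` in `C`. -/
theorem constraint_mapHom_ev (X : C) (V : D) :
    constraint (X ⊗ (H V).obj) (H M) (H ((X ⊗ (H V).obj) ⊙ₗ M)) ≫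
        mapHom H ((αₗ X (H V).obj M).hom ≫ X ⊴ₗ (H V).ev) =
      (α_ X (H V).obj (H M).obj).hom ≫ X ◁ comp (H V) (H M) (H V) ≫
        constraint X (H V) (H (X ⊙ₗ V)) := by
  apply hom_ext
  rw [comp_actionHomLeft, comp_actionHomLeft, comp_actionHomLeft, Category.assoc, Category.assoc,
    Category.assoc, mapHom_ev, constraint_ev, ← Category.assoc (constraint _ _ _ ⊵ₗ M),
    constraint_ev, MonoidalLeftAction.whiskerLeft_actionHomLeft]
  simp only [Category.assoc, Iso.inv_hom_id_assoc]
  rw [← actionHomRight_comp, comp_ev, actionHomRight_comp, actionHomRight_comp,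
    MonoidalLeftAction.associator_actionHom_assoc]
  simp

/-- The morphism `Hom(M, f)` determines `ev ≫ f`, and `ev` can be cancelled. -/
theorem functor_faithful_of_epi_ev (h : ∀ V, Epi (H V).ev) : (functor H).Faithful where
  map_injective {V W} f g hfg := by
    have := h V
    have hfg' : mapHom H f = mapHom H g := congrArg RightMod.Hom.hom hfg
    rw [← cancel_epi (H V).ev, ← mapHom_ev, ← mapHom_ev, hfg']

/-- The evaluation morphisms of a generator are epimorphisms. -/
theorem epi_ev_of_isGenerator (hM : IsGenerator C M) (V : D) : Epi (H V).ev := by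
  obtain ⟨X, f, hf⟩ := hM V
  rw [← curry_ev (H V) f] at hf
  exact epi_of_epi ((H V).curry f ⊵ₗ M) (H V).ev

end Functor

section Linear

variable {k : Type w} [Field k] {C : Type u₁} [Category.{v₁} C] [Abelian C]
    [Linear k C] [MonoidalCategory C] [MonoidalPreadditive C]
    {D : Type u₂} [Category.{v₂} D] [Abelian D] [Linear k D]
    [MonoidalLeftAction C D] {M : D} (H : ∀ V : D, InternalHom C M V)

theorem functor_additive (hD : IsSemisimpleModuleCat k C D) : (functor H).Additive where
  map_add {V W f g} := by
    ext
    change mapHom H (f + g) = mapHom H f + mapHom H g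
    apply hom_ext
    rw [mapHom_ev, hD.add_left, Preadditive.add_comp, mapHom_ev, mapHom_ev, Preadditive.comp_add]

theorem functor_linear [MonoidalLinear k C] (hD : IsSemisimpleModuleCat k C D) : (functor H).Linear k where
  map_smul {V W} f r := by
    ext
    change mapHom H (r • f) = r • mapHom H f
    apply hom_ext
    rw [mapHom_ev, hD.smul_left, Linear.smul_comp, mapHom_ev, Linear.comp_smul]

end Linear

/-! ### Unit and counit between `- ⊗_A M` and `Hom(M, -)` -/

section Adjunction

variable {C : Type u₁} [Category.{v₁} C] [MonoidalCategory C] {D : Type u₂} [Category.{v₂} D]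
  [MonoidalLeftAction C D] [HasCoequalizers D] {M : D} (H : ∀ V : D, InternalHom C M V)

/-- The counit `Hom(M, V) ⊗_A M ⟶ V`, induced by evaluation. -/
noncomputable def tensorCounit (V : D) : tensorOver ((functor H).obj V) M ⟶ V :=
  coequalizer.desc (H V).ev ((comp_ev (H V) (H M) (H V)).trans (Category.assoc _ _ _).symm)

theorem tensorOverπ_counit (V : D) :
    tensorOverπ ((functor H).obj V) M ≫ tensorCounit H V = (H V).ev :=
  coequalizer.π_desc _ _

theorem tensorCounit_naturality {V W : D} (f : V ⟶ W) :
    tensorOverMap ((functor H).map f) M ≫ tensorCounit H W = tensorCounit H V ≫ f := by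
  apply tensorOver_hom_ext
  rw [← Category.assoc, tensorOverπ_map, Category.assoc, tensorOverπ_counit,
    ← Category.assoc, tensorOverπ_counit]
  exact mapHom_ev H f

/-- The morphism `U ⟶ Hom(M, U ⊗_A M)` of `C` induced by the projection `U ⊙ₗ M ⟶ U ⊗_A M`. -/
noncomputable def tensorUnitHom (U : RightMod (H M).obj) : U.X ⟶ (H (tensorOver U M)).obj :=
  (H _).curry (tensorOverπ U M)

theorem tensorUnitHom_ev (U : RightMod (H M).obj) :
    tensorUnitHom H U ⊵ₗ M ≫ (H (tensorOver U M)).ev = tensorOverπ U M :=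
  curry_ev _ _

theorem act_tensorUnitHom (U : RightMod (H M).obj) :
    U.act ≫ tensorUnitHom H U = tensorUnitHom H U ▷ (H M).obj ≫ comp (H _) (H M) (H _) := by
  apply hom_ext
  have e := action_exchange (tensorUnitHom H U) (H M).ev
  rw [comp_actionHomLeft, comp_actionHomLeft, Category.assoc, Category.assoc, comp_ev,
    tensorUnitHom_ev, tensorOver_condition, MonoidalLeftAction.whiskerRight_actionHomLeft]
  simp only [Category.assoc, Iso.inv_hom_id_assoc]
  rw [← reassoc_of% e, tensorUnitHom_ev]
  rfl

/-- The unit `U ⟶ Hom(M, U ⊗_A M)`. -/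
noncomputable def tensorUnit (U : RightMod (H M).obj) :
    U ⟶ (functor H).obj (tensorOver U M) where
  hom := tensorUnitHom H U
  act_hom := act_tensorUnitHom H U

theorem tensorUnit_naturality {U U' : RightMod (H M).obj} (f : U ⟶ U') :
    f ≫ tensorUnit H U' = tensorUnit H U ≫ (functor H).map (tensorOverMap f M) := by
  ext
  change f.hom ≫ tensorUnitHom H U' = tensorUnitHom H U ≫ mapHom H (tensorOverMap f M)
  apply hom_ext
  rw [comp_actionHomLeft, comp_actionHomLeft, Category.assoc, Category.assoc, mapHom_ev,
    tensorUnitHom_ev, ← Category.assoc, tensorUnitHom_ev, tensorOverπ_map]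

/-- The one triangle identity needed: when the unit is invertible, it makes the image of the counit
under `Hom(M, -)` invertible too. -/
theorem tensorUnit_functor_map_counit (V : D) :
    tensorUnit H ((functor H).obj V) ≫ (functor H).map (tensorCounit H V) = 𝟙 _ := by
  ext
  have h : tensorUnitHom H ((functor H).obj V) ⊵ₗ M ≫ mapHom H (tensorCounit H V) ⊵ₗ M ≫
      (H V).ev = (𝟙 (H V).obj) ⊵ₗ M ≫ (H V).ev := by
    rw [mapHom_ev, ← Category.assoc, tensorUnitHom_ev, tensorOverπ_counit]
    exact (by simp : (H V).ev = 𝟙 (H V).obj ⊵ₗ M ≫ (H V).ev)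
  rw [← comp_actionHomLeft_assoc] at h
  exact hom_ext _ h

/-- Since `U.act` is a split epimorphism in `C`, this expresses the unit at `U` through the image of
the coequalizer projection. -/
theorem constraint_mapHom_tensorOverπ (U : RightMod (H M).obj) :
    constraint U.X (H M) (H (U.X ⊙ₗ M)) ≫ mapHom H (tensorOverπ U M) =
      U.act ≫ tensorUnitHom H U := by
  apply hom_ext
  rw [comp_actionHomLeft, comp_actionHomLeft, Category.assoc, Category.assoc, mapHom_ev,
    tensorUnitHom_ev, ← Category.assoc, constraint_ev, tensorOver_condition, Category.assoc]
  rfl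

end Adjunction

/-! ### Invertibility of the unit and the counit -/

section Unit

variable {C : Type u₁} [Category.{v₁} C] [Abelian C] [MonoidalCategory C]
  [MonoidalPreadditive C] {D : Type u₂} [Category.{v₂} D] [Abelian D]
  [MonoidalLeftAction C D] {M : D} (H : ∀ V : D, InternalHom C M V)

theorem mapHom_add [(functor H).Additive] {V W : D} (f g : V ⟶ W) :
    mapHom H (f + g) = mapHom H f + mapHom H g :=
  congrArg RightMod.Hom.hom ((functor H).map_add (f := f) (g := g))

theorem isIso_tensorUnitHom [(functor H).Additive] (hD : ∀ V : D, IsSemisimpleObj V)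
    (hc : ∀ (X : C) (V : D), IsIso (constraint X (H V) (H (X ⊙ₗ V))))
    (U : RightMod (H M).obj) : IsIso (tensorUnitHom H U) := by
  obtain ⟨s, t, hs, ht⟩ := exists_splitting_of_coequalizer hD (U.act ⊵ₗ M)
    ((αₗ U.X (H M).obj M).hom ≫ U.X ⊴ₗ (H M).ev)
  change tensorOver U M ⟶ U.X ⊙ₗ M at s
  change s ≫ tensorOverπ U M = 𝟙 _ at hs
  change 𝟙 _ - tensorOverπ U M ≫ s = _ at ht
  have hci := hc U.X M
  have hci' := hc (U.X ⊗ (H M).obj) M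
  have hcπ := constraint_mapHom_tensorOverπ H U
  have h₁ := constraint_mapHom_actionHomLeft H U.act M
  have h₂ := constraint_mapHom_ev H U.X M
  have h₃ : U.X ◁ comp (H M) (H M) (H M) ≫ U.act =
      (α_ U.X (H M).obj (H M).obj).inv ≫ U.act ▷ (H M).obj ≫ U.act := U.act_mul
  have hact : (U.X ◁ (H M).one ≫ U.act) = (ρ_ U.X).hom := U.act_one
  have : Epi U.act := by
    have : Epi (U.X ◁ (H M).one ≫ U.act) := by rw [hact]; infer_instance
    exact epi_of_epi (U.X ◁ (H M).one) U.act
  set c := constraint U.X (H M) (H (U.X ⊙ₗ M))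
  set c' := constraint (U.X ⊗ (H M).obj) (H M) (H ((U.X ⊗ (H M).obj) ⊙ₗ M))
  set a := U.act ⊵ₗ M
  set b := (αₗ U.X (H M).obj M).hom ≫ U.X ⊴ₗ (H M).ev
  -- After transport along `c'` and `c`, this is associativity of the action on `U`.
  have hab : mapHom H a ≫ inv c ≫ U.act = mapHom H b ≫ inv c ≫ U.act := by
    rw [← cancel_epi c', reassoc_of% h₁, reassoc_of% h₂, IsIso.hom_inv_id_assoc, h₃]
    simp
  -- The splitting is written without subtraction so that `mapHom_add` applies; after composing with
  -- `inv c ≫ U.act` the terms in `t` cancel by `hab`.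
  have hsplit : 𝟙 _ + t ≫ b = tensorOverπ U M ≫ s + t ≫ a := by
    rw [Preadditive.comp_sub, sub_eq_sub_iff_add_eq_add] at ht
    rw [ht, add_comm]
  have hsub : mapHom H (tensorOverπ U M) ≫ mapHom H s ≫ inv c ≫ U.act = inv c ≫ U.act := by
    have h := congrArg (fun f => mapHom H f ≫ inv c ≫ U.act) hsplit
    simp only [mapHom_add, mapHom_comp, mapHom_id, Preadditive.add_comp, Category.assoc,
      Category.id_comp, hab] at h
    exact (add_right_cancel h).symm
  refine ⟨mapHom H s ≫ inv c ≫ U.act, ?_, ?_⟩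
  · rw [← cancel_epi U.act, ← Category.assoc, ← hcπ, Category.assoc, hsub]
    simp
  · rw [Category.assoc, Category.assoc, ← hcπ, IsIso.inv_hom_id_assoc, ← mapHom_comp, hs,
      mapHom_id]

theorem isIso_tensorUnit [(functor H).Additive] (hD : ∀ V : D, IsSemisimpleObj V)
    (hc : ∀ (X : C) (V : D), IsIso (constraint X (H V) (H (X ⊙ₗ V))))
    (U : RightMod (H M).obj) : IsIso (tensorUnit H U) := by
  have := isIso_tensorUnitHom H hD hc U
  exact (RightMod.mkIso (U' := (functor H).obj (tensorOver U M)) (@asIso _ _ _ _ _ this)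
    (act_tensorUnitHom H U)).isIso_hom

/-- The faithful functor `Hom(M, -)` sends the counit to an isomorphism, so the counit is mono and
epi, hence invertible because `D` is abelian. -/
theorem isIso_tensorCounit [(functor H).Additive] (hD : ∀ V : D, IsSemisimpleObj V)
    (hc : ∀ (X : C) (V : D), IsIso (constraint X (H V) (H (X ⊙ₗ V))))
    (hev : ∀ V, Epi (H V).ev) (V : D) : IsIso (tensorCounit H V) := by
  have := functor_faithful_of_epi_ev H hev
  have := isIso_tensorUnit H hD hc ((functor H).obj V)
  have : IsIso ((functor H).map (tensorCounit H V)) := by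
    rw [← IsIso.inv_eq_of_hom_inv_id (tensorUnit_functor_map_counit H V)]
    infer_instance
  have : Mono (tensorCounit H V) := (functor H).mono_of_mono_map inferInstance
  have : Epi (tensorCounit H V) := (functor H).epi_of_epi_map inferInstance
  exact isIso_of_mono_of_epi _

/-- `Hom(M, -) ⊗_A M` is isomorphic to the identity. -/
noncomputable def tensorCounitIso [(functor H).Additive] (hD : ∀ V : D, IsSemisimpleObj V)
    (hc : ∀ (X : C) (V : D), IsIso (constraint X (H V) (H (X ⊙ₗ V))))
    (hev : ∀ V, Epi (H V).ev) :
    functor H ⋙ tensorOverFunctor (H M).obj M ≅ 𝟭 D :=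
  NatIso.ofComponents
    (fun V => @asIso _ _ _ _ (tensorCounit H V) (isIso_tensorCounit H hD hc hev V))
    (fun f => tensorCounit_naturality H f)

/-- `Hom(M, - ⊗_A M)` is isomorphic to the identity. -/
noncomputable def tensorUnitIso [(functor H).Additive] (hD : ∀ V : D, IsSemisimpleObj V)
    (hc : ∀ (X : C) (V : D), IsIso (constraint X (H V) (H (X ⊙ₗ V)))) :
    𝟭 (RightMod (H M).obj) ≅ tensorOverFunctor (H M).obj M ⋙ functor H :=
  NatIso.ofComponents (fun U => @asIso _ _ _ _ (tensorUnit H U) (isIso_tensorUnit H hD hc U))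
    (fun f => tensorUnit_naturality H f)

end Unit

end InternalHom

/-! ### Transport of simplicity and semisimplicity along equivalences -/

section Transport

variable {C : Type u₁} [Category.{v₁} C] [Preadditive C] {D : Type u₂} [Category.{v₂} D]
  [Preadditive D] (F : C ⥤ D) [F.IsEquivalence] [F.Additive]

theorem simple_of_simple_map (X : C) [Simple (F.obj X)] : Simple X where
  mono_isIso_iff_nonzero {Y} f _ := by
    rw [← isIso_iff_of_reflects_iso f F, Simple.mono_isIso_iff_nonzero, ne_eq, ne_eq,
      F.map_eq_zero_iff]

theorem simple_map_iff (X : C) : Simple (F.obj X) ↔ Simple X := by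
  refine ⟨fun _ => simple_of_simple_map F X, fun _ => ?_⟩
  have : Simple (F.inv.obj (F.obj X)) := (Simple.iff_of_iso (F.asEquivalence.unitIso.app X)).1 ‹_›
  have : F.asEquivalence.functor.Additive := ‹F.Additive›
  have : F.inv.Additive := F.asEquivalence.inverse_additive
  exact simple_of_simple_map F.inv (F.obj X)

theorem isSemisimpleObj_map {X : C} (hX : IsSemisimpleObj X) : IsSemisimpleObj (F.obj X) := by
  obtain ⟨n, S, b, hS, ⟨hb⟩, ⟨e⟩⟩ := hX
  exact ⟨n, fun i => F.obj (S i), F.mapBicone b, fun i => (simple_map_iff F _).2 (hS i),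
    ⟨isBilimitOfPreserves F hb⟩, ⟨F.mapIso e⟩⟩

end Transport

/-- A preadditive category equivalent to a semisimple one by an additive functor is semisimple. -/
theorem isSemisimpleCat_of_equivalence {C : Type u₁} [Category.{v₁} C] [Abelian C]
    {D : Type u₂} [Category.{v₂} D] [Preadditive D] (F : C ⥤ D) [F.IsEquivalence] [F.Additive]
    (hC : ∀ X : C, IsSemisimpleObj X) : IsSemisimpleCat D where
  abelian := by
    have : HasFiniteProducts D :=
      ⟨fun n => Adjunction.hasLimitsOfShape_of_equivalence F.inv⟩
    -- The `rfl` checks that the abelian structure extends the given preadditive structure of `D`.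
    exact ⟨abelianOfEquivalence F.inv, rfl⟩
  semisimple Y := by
    obtain ⟨n, S, b, hS, hb, ⟨e⟩⟩ := isSemisimpleObj_map F (hC (F.objPreimage Y))
    exact ⟨n, S, b, hS, hb, ⟨e ≪≫ F.objObjPreimageIso Y⟩⟩

end FusionModule

/-! ### The main theorem -/

open FusionModule in
theorem mainTheorem3 {k : Type*} [Field k] {C : Type*} [Category* C] [Abelian C] [Linear k C]
    [MonoidalCategory C] [MonoidalPreadditive C] [MonoidalLinear k C] (hC : IsFusionCat k C)
    {D : Type*} [Category* D] [Abelian D] [Linear k D] [MonoidalLeftAction C D]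
    (hD : IsSemisimpleModuleCat k C D) (M : D) (hM : IsGenerator C M) :
    (∀ N V : D, Nonempty (InternalHom C N V)) ∧
    ∀ H : ∀ V : D, InternalHom C M V,
      IsSemisimpleAlg (H M).obj ∧
      (InternalHom.functor H).IsEquivalence ∧
      Functor.Linear k (InternalHom.functor H) ∧
      (∀ (X : C) (V : D), IsIso (Functor.LaxLeftLinear.μₗ (InternalHom.functor H) X V)) ∧
      Nonempty (InternalHom.functor H ⋙ tensorOverFunctor (H M).obj M ≅ 𝟭 D) ∧
      Nonempty (tensorOverFunctor (H M).obj M ⋙ InternalHom.functor H ≅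
        𝟭 (RightMod (H M).obj)) ∧
      (∀ V : D, Nonempty (tensorOver ((InternalHom.functor H).obj V) M ≅ V)) ∧
      (∀ U : RightMod (H M).obj, Nonempty (U ≅ (InternalHom.functor H).obj (tensorOver U M))) ∧
      (∀ V : D, Simple V ↔ Simple ((InternalHom.functor H).obj V)) ∧
      (∀ U : RightMod (H M).obj, Simple U ↔ Simple (tensorOver U M)) := by
  refine ⟨nonempty_internalHom hC hD, fun H => ?_⟩
  have hadd := InternalHom.functor_additive H hD
  have hss := hD.semisimple.semisimple
  have hc : ∀ (X : C) (V : D), IsIso (InternalHom.constraint X (H V) (H (X ⊙ₗ V))) := by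
    intro X V
    obtain ⟨hX⟩ := hC.right_rigid X
    exact InternalHom.isIso_constraint X Xᘁ (H V) (H (X ⊙ₗ V))
  have hev := InternalHom.epi_ev_of_isGenerator H hM
  let ε := InternalHom.tensorCounitIso H hss hc hev
  let υ := InternalHom.tensorUnitIso H hss hc
  have heq : (InternalHom.functor H).IsEquivalence :=
    (CategoryTheory.Equivalence.mk (InternalHom.functor H) (tensorOverFunctor (H M).obj M)
      ε.symm υ.symm).isEquivalence_functor
  refine ⟨isSemisimpleCat_of_equivalence (InternalHom.functor H) hss, heq,
    InternalHom.functor_linear H hD, fun X V => ?_, ⟨ε⟩, ⟨υ.symm⟩, fun V => ⟨ε.app V⟩,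
    fun U => ⟨υ.app U⟩, fun V => (simple_map_iff _ V).symm, fun U => ?_⟩
  · have := hc X V
    exact (RightMod.mkIso (U := X ⊙ₗ (InternalHom.functor H).obj V)
      (U' := (InternalHom.functor H).obj (X ⊙ₗ V)) (@asIso _ _ _ _ _ this)
      (Functor.LaxLeftLinear.μₗ (InternalHom.functor H) X V).act_hom).isIso_hom
  -- Simplicity of `U` is that of the isomorphic module `Hom(M, U ⊗_A M)`, the image of `U ⊗_A M`
  -- under the equivalence.
  · exact (Simple.iff_of_iso (υ.app U)).trans (simple_map_iff (InternalHom.functor H) _)
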